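/- Let $a_1,a_2,a_3,a_4$ be real polynomials with $\deg a_k\le k$ for each $k$ and $a_4\neq 0$, and let $L=\sum_{k=1}^{4}a_k(x)\,D^k$, where $D=d/dx$. Suppose that $L$ is self-adjoint in the following sense: there are a nondegenerate interval $I\subseteq\mathbb{R}$, bounded or unbounded, and a function $p$ that is piecewise smooth on $I$ (that is, $C^\infty$ in the interior of $I$ away from a set having only finitely many points in each compact interval), with $\int_I |p\,u|\,dx<\infty$ for every polynomial $u$, such that $\langle u,v\rangle=\int_I p\,u\,v\,dx$ is an inner product on the space $\mathcal{E}$ of (restrictions to $I$ of) $C^\infty$ functions on $\mathbb{R}$ that are, together with each of their derivatives, bounded by a polynomial, and $\langle Lu,v\rangle=\langle u,Lv\rangle$ for all $u,v\in\mathcal{E}$. (If $I$ is bounded, $\mathcal{E}$ consists of the restrictions to $I$ of all $C^\infty$ functions on $\mathbb{R}$.) If $a_4$ has more than one real root, then $a_4$ has exactly two distinct real roots, each of them is a root of $a_4$ of multiplicity exactly $2$, and each of them is a root of $a_3$ of multiplicity exactly $1$. -/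

import Mathlib

open scoped ContDiff

noncomputable section

namespace PolyDiffOp

/-- The differential operator `L = ∑_{k=1}^{n} a_k D^k` with polynomial coefficients,
applied to a function `y : ℝ → ℝ`. -/
def apply (n : ℕ) (a : ℕ → Polynomial ℝ) (y : ℝ → ℝ) (x : ℝ) : ℝ :=
  ∑ k ∈ Finset.Icc 1 n, (a k).eval x * iteratedDeriv k y x

/-- `L = ∑_{k=1}^{n} a_k D^k` has order exactly `n`, and `deg a_k ≤ k` for every `k`, so that
`L` maps polynomials of degree at most `N` to such polynomials, for every `N`. -/
structure HasOrder (n : ℕ) (a : ℕ → Polynomial ℝ) : Prop where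
  leading_ne_zero : a n ≠ 0
  natDegree_le : ∀ k ∈ Finset.Icc 1 n, (a k).natDegree ≤ k

/-- The bilinear form `⟨u, v⟩ = ∫_I p u v dx`. -/
def form (I : Set ℝ) (p u v : ℝ → ℝ) : ℝ :=
  ∫ x in I, p x * u x * v x

/-- `p` is piecewise smooth on `I`: it is `C^∞` in the interior of `I` away from a set of
points of which every compact interval contains only finitely many. Nothing is required at
these points or at the endpoints of `I` (classical weights may blow up there). -/
def PiecewiseSmooth (I : Set ℝ) (p : ℝ → ℝ) : Prop :=
  ∃ S : Set ℝ, (∀ c d : ℝ, (S ∩ Set.Icc c d).Finite) ∧ ContDiffOn ℝ ∞ p (interior I \ S)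

/-- `p` is an admissible weight on `I`: it is piecewise smooth, `p u` is integrable over `I` for
every polynomial `u`, and `⟨u, v⟩ = ∫_I p u v dx` is positive definite on the smooth functions.

The smooth functions used are those of `Function.HasTemperateGrowth`, that is, the `C^∞`
functions which are bounded by a polynomial together with each of their derivatives: for these
the integrals converge. On a bounded interval they have the same restrictions as all `C^∞`
functions on `ℝ`; polynomials and compactly supported `C^∞` functions are always among them. -/
structure IsAdmissibleWeight (I : Set ℝ) (p : ℝ → ℝ) : Prop where
  piecewiseSmooth : PiecewiseSmooth I p
  integrable : ∀ u : Polynomial ℝ, MeasureTheory.IntegrableOn (fun x => p x * u.eval x) I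
  posDef : ∀ u : ℝ → ℝ, u.HasTemperateGrowth → (∃ x ∈ I, u x ≠ 0) → 0 < form I p u u

/-- `L = ∑_{k=1}^{n} a_k D^k` is a self-adjoint operator of order `n`: for some nondegenerate
interval `I` (bounded or not) and some admissible weight `p` on `I`, one has
`⟨L u, v⟩ = ⟨u, L v⟩` for all smooth `u` and `v`. -/
def IsSelfAdjointOfOrder (n : ℕ) (a : ℕ → Polynomial ℝ) : Prop :=
  HasOrder n a ∧
    ∃ (I : Set ℝ) (p : ℝ → ℝ), I.OrdConnected ∧ (interior I).Nonempty ∧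
      IsAdmissibleWeight I p ∧
      ∀ u v : ℝ → ℝ, u.HasTemperateGrowth → v.HasTemperateGrowth →
        form I p (apply n a u) v = form I p u (apply n a v)

end PolyDiffOp

end

open scoped ContDiff
open MeasureTheory

/-! Let `P` be the weight extended by zero and `b = a₃/2 - a₄'`. Commuting `L` with multiplication
by `x` turns symmetry into two weak equations, `(2 a₄ P)' = a₃ P` and `(a₃ P)'' - 2 (a₂ P)' + 2 a₁ P
= 0`. They hold on the whole line, so they also encode boundary conditions at the ends of `I`. Off
the roots of `a₄` the first says `P'/P = b/a₄` (`WeakWeight.exists_const`); the second then becomes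
the polynomial identity `compat = 0` (`WeakWeight.compat_eq_zero`).

At a finite end `r` (`WeakWeight.right_end`), `a₃` must vanish to lower order than `a₄`: otherwise
`P` is not integrable or continues past `r`. If `r` is a simple root of `a₄` with `a₃(r) ≠ 0`, then
`P` has local exponent 0 or 1 and a boundary term survives. So `a₄` has multiplicity at least 2; if
it is exactly 2, `compat = 0` gives `a₃(r) = 0`, and this zero is simple.

At infinity, counting degrees in `compat = 0` gives `deg b < deg a₄`, or both degrees are 2
(`natDegree_logNum`). In the first case `P` decays no faster than a power, so its moments force `I`
to be bounded, and two roots of multiplicity at least 2 fill degree 4. In the second the two given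
roots are simple, so `I` has no finite end; but `P'/P` has a nonzero limit at infinity, so `|P|`
fails to decay in one direction. -/

/-! ### Primitives and the lemma of du Bois-Reymond -/

theorem exists_primitive_of_integral_eq_zero {J : Set ℝ} (hJc : J.OrdConnected) (hne : J.Nonempty)
    {g : ℝ → ℝ} (hg : ContDiff ℝ ∞ g) (hgc : HasCompactSupport g) (hgJ : tsupport g ⊆ J)
    (h0 : ∫ x, g x = 0) :
    ∃ Φ : ℝ → ℝ, ContDiff ℝ ∞ Φ ∧ HasCompactSupport Φ ∧ tsupport Φ ⊆ J ∧
      ∀ x, deriv Φ x = g x := by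
  obtain ⟨a, b, hab, haJ, hbJ, hs⟩ : ∃ a b : ℝ, a ≤ b ∧ a ∈ J ∧ b ∈ J ∧
      tsupport g ⊆ Set.Icc a b := by
    rcases (tsupport g).eq_empty_or_nonempty with he | hn
    · obtain ⟨x, hx⟩ := hne
      exact ⟨x, x, le_rfl, hx, hx, by simp [he]⟩
    · obtain ⟨a, ha⟩ := hgc.isCompact.exists_isLeast hn
      obtain ⟨b, hb⟩ := hgc.isCompact.exists_isGreatest hn
      exact ⟨a, b, ha.2 hb.1, hgJ ha.1, hgJ hb.1, fun x hx => ⟨ha.2 hx, hb.2 hx⟩⟩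
  have hz : ∀ x, x ∉ Set.Icc a b → g x = 0 := fun x hx =>
    image_eq_zero_of_notMem_tsupport fun h => hx (hs h)
  have hd : ∀ x, deriv (fun x => ∫ t in a..x, g t) x = g x := fun x =>
    hg.continuous.deriv_integral g a x
  have hda : ∀ x, HasDerivAt (fun x => ∫ t in a..x, g t) (g x) x := fun x =>
    intervalIntegral.integral_hasDerivAt_right (hg.continuous.intervalIntegrable _ _)
      (hg.continuous.stronglyMeasurableAtFilter _ _) hg.continuous.continuousAt
  have hsupp : tsupport (fun x => ∫ t in a..x, g t) ⊆ Set.Icc a b := by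
    refine closure_minimal (fun x hx => ?_) isClosed_Icc
    by_contra hx'
    apply hx
    rw [Set.mem_Icc, not_and_or, not_le, not_le] at hx'
    rcases hx' with hx' | hx'
    · refine intervalIntegral.integral_zero_ae ?_
      filter_upwards [(measure_eq_zero_iff_ae_notMem).1 (measure_singleton (μ := volume) a)]
        with t hta ht
      rw [Set.uIoc_of_ge hx'.le] at ht
      exact hz t fun h => hta (le_antisymm ht.2 h.1)
    · beta_reduce
      rw [intervalIntegral.integral_of_le (hab.trans hx'.le), ← h0,
        ← integral_indicator measurableSet_Ioc]
      refine integral_congr_ae ?_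
      filter_upwards [(measure_eq_zero_iff_ae_notMem).1 (measure_singleton (μ := volume) a)]
        with t hta
      by_cases ht : t ∈ Set.Ioc a x
      · simp [ht]
      · rw [Set.indicator_of_notMem ht, hz t]
        exact fun h => ht ⟨lt_of_le_of_ne h.1 (fun e => hta e.symm), h.2.trans hx'.le⟩
  refine ⟨fun x => ∫ t in a..x, g t, ?_, ?_, hsupp.trans (hJc.out haJ hbJ), hd⟩
  · rw [contDiff_infty_iff_deriv]
    refine ⟨fun x => (hda x).differentiableAt, ?_⟩
    rw [funext hd]
    exact hg
  · exact isCompact_Icc.of_isClosed_subset (isClosed_tsupport _) hsupp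

/-- The lemma of du Bois-Reymond. -/
theorem exists_const_of_integral_mul_deriv_eq_zero {J : Set ℝ} (hJ : IsOpen J)
    (hJc : J.OrdConnected) (hne : J.Nonempty) {f : ℝ → ℝ} (hf : LocallyIntegrableOn f J)
    (h : ∀ φ : ℝ → ℝ, ContDiff ℝ ∞ φ → HasCompactSupport φ → tsupport φ ⊆ J →
      ∫ x, f x * deriv φ x = 0) :
    ∃ C : ℝ, ∀ᵐ x, x ∈ J → f x = C := by
  obtain ⟨x₀, hx₀⟩ := hne
  obtain ⟨ψ, hψJ, hψc, hψ, hψr, hψ1⟩ :=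
    exists_contDiff_tsupport_subset (n := ⊤) (hJ.mem_nhds hx₀)
  have hψp : 0 < ∫ x, ψ x :=
    hψ.continuous.integral_pos_of_hasCompactSupport_nonneg_nonzero hψc
      (fun x => (hψr ⟨x, rfl⟩).1) (x := x₀) (by simp [hψ1])
  have hint : ∀ φ : ℝ → ℝ, ContDiff ℝ ∞ φ → HasCompactSupport φ → tsupport φ ⊆ J →
      Integrable fun x => φ x * f x := fun φ hφ hφc hφJ => by
    have h1 : IntegrableOn f (tsupport φ) := hf.integrableOn_compact_subset hφJ hφc.isCompact
    have h2 := h1.continuousOn_mul hφ.continuous.continuousOn hφc.isCompact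
    refine (integrableOn_iff_integrable_of_support_subset fun x hx => ?_).1 h2
    exact subset_tsupport φ fun h0 => hx (by simp [h0])
  refine ⟨(∫ x, ψ x * f x) / ∫ x, ψ x, ?_⟩
  set C := (∫ x, ψ x * f x) / ∫ x, ψ x with hC
  have key := hJ.ae_eq_zero_of_integral_contDiff_smul_eq_zero (f := fun x => f x - C)
    (μ := volume) (hf.sub ((locallyIntegrable_const C).locallyIntegrableOn J)) ?_
  · filter_upwards [key] with x hx hxJ
    exact sub_eq_zero.1 (hx hxJ)
  intro φ hφ hφc hφJ
  have hφi := hφ.continuous.integrable_of_hasCompactSupport hφc (μ := volume)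
  have hψi := hψ.continuous.integrable_of_hasCompactSupport hψc (μ := volume)
  -- This `m` makes `φ - m ψ` have integral zero, hence the derivative of a test function.
  set m := (∫ x, φ x) / ∫ x, ψ x with hm
  obtain ⟨Φ, h1, h2, h3, h4⟩ := exists_primitive_of_integral_eq_zero hJc ⟨x₀, hx₀⟩
    (g := fun x => φ x - m * ψ x) (hφ.sub (contDiff_const.mul hψ)) (hφc.sub hψc.mul_left)
    ((tsupport_sub _ _).trans (Set.union_subset hφJ (closure_minimal
      ((Function.support_mul_subset_right _ _).trans ((subset_tsupport ψ))) (isClosed_tsupport _)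
        |>.trans hψJ)))
    (by
      rw [integral_sub hφi (hψi.const_mul m), integral_const_mul, hm]
      field_simp
      simp)
  have h5 := h Φ h1 h2 h3
  have e1 : (fun x => f x * deriv Φ x) = fun x => φ x * f x - m * (ψ x * f x) := by
    funext x; rw [h4]; ring
  rw [e1, integral_sub (hint φ hφ hφc hφJ) ((hint ψ hψ hψc hψJ).const_mul m),
    integral_const_mul] at h5
  have e2 : (fun x => φ x • (f x - C)) = fun x => φ x * f x - C * φ x := by
    funext x; rw [smul_eq_mul]; ring
  rw [e2, integral_sub (hint φ hφ hφc hφJ) (hφi.const_mul C), integral_const_mul]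
  rw [← h5, hm, hC]
  ring

/-- A smooth function on an open interval has a smooth primitive. -/
theorem exists_primitive_of_contDiffOn {J : Set ℝ} (hJ : IsOpen J) (hJc : J.OrdConnected)
    {k : ℝ → ℝ} (hk : ContDiffOn ℝ ∞ k J) :
    ∃ G : ℝ → ℝ, ContDiffOn ℝ ∞ G J ∧ ∀ x ∈ J, HasDerivAt G (k x) x := by
  rcases J.eq_empty_or_nonempty with rfl | ⟨a, ha⟩
  · exact ⟨0, by simp [contDiffOn_empty], by simp⟩
  have hd : ∀ x ∈ J, HasDerivAt (fun x => ∫ t in a..x, k t) (k x) x := fun x hx => by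
    refine intervalIntegral.integral_hasDerivAt_right ?_ ?_ ?_
    · exact (hk.continuousOn.mono (hJc.uIcc_subset ha hx)).intervalIntegrable
    · exact hk.continuousOn.stronglyMeasurableAtFilter hJ x hx
    · exact hk.continuousOn.continuousAt (hJ.mem_nhds hx)
  refine ⟨_, ?_, hd⟩
  rw [contDiffOn_infty_iff_deriv_of_isOpen hJ]
  exact ⟨fun x hx => (hd x hx).differentiableAt.differentiableWithinAt,
    hk.congr fun x hx => (hd x hx).deriv⟩

/-! ### From symmetry to weak equations for the weight -/

theorem HasCompactSupport.iteratedDeriv_of_real {u : ℝ → ℝ} (hu : HasCompactSupport u) (k : ℕ) :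
    HasCompactSupport (iteratedDeriv k u) := by
  induction k with
  | zero => simpa using hu
  | succ k ih => rw [iteratedDeriv_succ]; exact ih.deriv

theorem MeasureTheory.Integrable.mul_hasCompactSupport {μ : Measure ℝ} {p K : ℝ → ℝ}
    (hp : Integrable p μ) (hK : Continuous K) (hKc : HasCompactSupport K) :
    Integrable (fun x => p x * K x) μ := by
  obtain ⟨C, hC⟩ := hK.bounded_above_of_compact_support hKc
  exact hp.mul_bdd (c := C) hK.aestronglyMeasurable (Filter.Eventually.of_forall hC)

namespace PolyDiffOp

theorem apply_four (a : ℕ → Polynomial ℝ) (y : ℝ → ℝ) (x : ℝ) :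
    apply 4 a y x = (a 1).eval x * iteratedDeriv 1 y x + (a 2).eval x * iteratedDeriv 2 y x +
      (a 3).eval x * iteratedDeriv 3 y x + (a 4).eval x * iteratedDeriv 4 y x := by
  simp [apply, show Finset.Icc 1 4 = {1, 2, 3, 4} from rfl]
  ring

theorem apply_four_pow_mul (a : ℕ → Polynomial ℝ) {u : ℝ → ℝ} (hu : ContDiff ℝ ∞ u) (i : ℕ)
    (x : ℝ) :
    apply 4 a (fun x => x ^ i * u x) x = ∑ k ∈ Finset.Icc 1 4, (a k).eval x *
      ∑ l ∈ Finset.range (k + 1), k.choose l * (i.descFactorial l * x ^ (i - l)) *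
        iteratedDeriv (k - l) u x := by
  unfold apply
  refine Finset.sum_congr rfl fun k _ => ?_
  rw [iteratedDeriv_fun_mul (f := fun x : ℝ => x ^ i) (contDiff_id.pow i).contDiffAt
    (hu.of_le (by exact_mod_cast le_top)).contDiffAt]
  simp only [iteratedDeriv_pow]

/-- Varying `i` and `j` here produces the commutators of `L` with multiplication by `x`; the
compactly supported factor `u` need not be supported in `I`. -/
theorem form_pow_comm {a : ℕ → Polynomial ℝ} {I : Set ℝ} {p : ℝ → ℝ} (hp : IntegrableOn p I)
    (hL : ∀ u v : ℝ → ℝ, u.HasTemperateGrowth → v.HasTemperateGrowth →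
        form I p (apply 4 a u) v = form I p u (apply 4 a v))
    {u : ℝ → ℝ} (hu : ContDiff ℝ ∞ u) (huc : HasCompactSupport u) (i j : ℕ) :
    IntegrableOn (fun x => p x * (x ^ j * apply 4 a (fun x => x ^ i * u x) x -
        x ^ i * u x * apply 4 a (fun x => x ^ j) x)) I ∧
    ∫ x in I, p x * (x ^ j * apply 4 a (fun x => x ^ i * u x) x -
        x ^ i * u x * apply 4 a (fun x => x ^ j) x) = 0 := by
  have hcont : ∀ y : ℝ → ℝ, ContDiff ℝ ∞ y → Continuous (apply 4 a y) := fun y hy => by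
    unfold apply
    refine continuous_finsetSum _ fun k _ => (a k).continuous.mul ?_
    exact hy.continuous_iteratedDeriv k (by exact_mod_cast le_top)
  have hy : ContDiff ℝ ∞ fun x => x ^ i * u x := (contDiff_id.pow i).mul hu
  have hyc : HasCompactSupport fun x => x ^ i * u x := huc.mul_left
  have hv : ContDiff ℝ ∞ fun x : ℝ => x ^ j := contDiff_id.pow j
  have hAc : HasCompactSupport (apply 4 a fun x => x ^ i * u x) := by
    rw [show (apply 4 a fun x => x ^ i * u x) = _ from funext (apply_four a _)]
    have := fun k => (hyc.iteratedDeriv_of_real k).mul_left (f := fun x => (a k).eval x)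
    exact (((this 1).add (this 2)).add (this 3)).add (this 4)
  have i1 : IntegrableOn (fun x => p x * (x ^ j * apply 4 a (fun x => x ^ i * u x) x)) I :=
    hp.mul_hasCompactSupport (hv.continuous.mul (hcont _ hy)) hAc.mul_left
  have i2 : IntegrableOn (fun x => p x * (x ^ i * u x * apply 4 a (fun x => x ^ j) x)) I :=
    hp.mul_hasCompactSupport (hy.continuous.mul (hcont _ hv)) hyc.mul_right
  have e : (fun x => p x * (x ^ j * apply 4 a (fun x => x ^ i * u x) x -
        x ^ i * u x * apply 4 a (fun x => x ^ j) x)) =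
      fun x => p x * (x ^ j * apply 4 a (fun x => x ^ i * u x) x) -
        p x * (x ^ i * u x * apply 4 a (fun x => x ^ j) x) := by
    funext x; ring
  rw [e]
  refine ⟨i1.sub i2, ?_⟩
  rw [integral_sub i1 i2, sub_eq_zero]
  have := hL (fun x => x ^ i * u x) (fun x => x ^ j) (hyc.hasTemperateGrowth hy) (by fun_prop)
  unfold form at this
  convert this using 3 <;> ring

/-- The weak form, on the whole line, of the conditions that the symmetry of
`A₄ D⁴ + A₃ D³ + A₂ D² + A₁ D` puts on a weight `P` which vanishes outside `I`. -/
structure WeakWeight (A₁ A₂ A₃ A₄ : Polynomial ℝ) (I : Set ℝ) (P : ℝ → ℝ) : Prop where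
  integrable : ∀ q : Polynomial ℝ, Integrable fun x => P x * q.eval x
  first_order : ∀ u : ℝ → ℝ, ContDiff ℝ ∞ u → HasCompactSupport u →
    ∫ x, P x * (2 * A₄.eval x * deriv u x + A₃.eval x * u x) = 0
  second_order : ∀ u : ℝ → ℝ, ContDiff ℝ ∞ u → HasCompactSupport u →
    ∫ x, P x * (A₃.eval x * deriv (deriv u) x + 2 * A₂.eval x * deriv u x +
      2 * A₁.eval x * u x) = 0
  eq_zero : ∀ x ∉ I, P x = 0
  not_ae_zero : ∀ c d : ℝ, c < d → Set.Ioo c d ⊆ I → ¬ ∀ᵐ x, x ∈ Set.Ioo c d → P x = 0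

theorem WeakWeight.of_isAdmissibleWeight {a : ℕ → Polynomial ℝ} {I : Set ℝ} {p : ℝ → ℝ}
    (hI : I.OrdConnected) (hp : IsAdmissibleWeight I p)
    (hL : ∀ u v : ℝ → ℝ, u.HasTemperateGrowth → v.HasTemperateGrowth →
        form I p (apply 4 a u) v = form I p u (apply 4 a v)) :
    WeakWeight (a 1) (a 2) (a 3) (a 4) I (I.indicator p) := by
  have hm : MeasurableSet I := hI.measurableSet
  have hpi : IntegrableOn p I := by simpa using hp.integrable 1
  have hind : ∀ K : ℝ → ℝ, (fun x => I.indicator p x * K x) = I.indicator fun x => p x * K x := by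
    intro K; funext x; by_cases hx : x ∈ I <;> simp [hx]
  have hB := fun u hu huc i j => form_pow_comm hpi hL (u := u) hu huc i j
  have comb : ∀ {f g : ℝ → ℝ} (c : ℝ),
      (IntegrableOn (fun x => p x * f x) I ∧ ∫ x in I, p x * f x = 0) →
      (IntegrableOn (fun x => p x * g x) I ∧ ∫ x in I, p x * g x = 0) →
      IntegrableOn (fun x => p x * (f x + c * g x)) I ∧ ∫ x in I, p x * (f x + c * g x) = 0 := by
    intro f g c hf hg
    have e : (fun x => p x * (f x + c * g x)) = fun x => p x * f x + c * (p x * g x) := by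
      funext x; ring
    rw [e]
    refine ⟨hf.1.add (hg.1.const_mul c), ?_⟩
    rw [integral_add hf.1 (hg.1.const_mul c), integral_const_mul, hf.2, hg.2]
    simp
  have hset : Finset.Icc 1 4 = {1, 2, 3, 4} := rfl
  have first : ∀ u : ℝ → ℝ, ContDiff ℝ ∞ u → HasCompactSupport u →
      IntegrableOn (fun x => p x * (12 * (2 * (a 4).eval x * deriv u x + (a 3).eval x * u x))) I ∧
      ∫ x in I, p x * (12 * (2 * (a 4).eval x * deriv u x + (a 3).eval x * u x)) = 0 := by
    intro u hu huc
    -- The coefficients 1, -3, 3, -1 give the triple commutator of `L` with `x`, which is `24 a₄ D +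
    -- 6 a₃`; the terms with `L` applied to `x ^ j` contribute another `6 a₃ u`.
    have h := comb (-1) (comb 3 (comb (-3) (hB u hu huc 3 0) (hB u hu huc 2 1))
      (hB u hu huc 1 2)) (hB u hu huc 0 3)
    convert h using 6 <;>
    · simp only [apply_four_pow_mul a hu]
      simp only [apply_four, iteratedDeriv_pow, hset]
      simp [Finset.sum_range_succ, Nat.choose, Nat.descFactorial]
      ring
  have second : ∀ u : ℝ → ℝ, ContDiff ℝ ∞ u → HasCompactSupport u →
    ∫ x in I, p x * ((a 3).eval x * deriv (deriv u) x + 2 * (a 2).eval x * deriv u x +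
      2 * (a 1).eval x * u x) = 0 := by
    intro u hu huc
    have hu' : ContDiff ℝ ∞ (deriv u) := (contDiff_infty_iff_deriv.1 hu).2
    -- The simple commutator gives `4 a₄ u''' + 3 a₃ u'' + 2 a₂ u' + 2 a₁ u`; a sixth of `first` at
    -- `u''` removes `4 a₄ u''' + 2 a₃ u''`.
    have h := comb (-1 / 6) (comb (-1) (hB u hu huc 1 0) (hB u hu huc 0 1))
      (first _ (contDiff_infty_iff_deriv.1 hu').2 huc.deriv.deriv)
    convert h.2 using 4
    simp only [apply_four_pow_mul a hu]
    simp only [apply_four, iteratedDeriv_pow, hset]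
    simp [Finset.sum_range_succ, Nat.choose, Nat.descFactorial, iteratedDeriv_succ]
    ring
  refine ⟨fun q => ?_, fun u hu huc => ?_, fun u hu huc => ?_, fun x hx => by simp [hx], ?_⟩
  · rw [hind, integrable_indicator_iff hm]
    exact hp.integrable q
  · rw [hind, integral_indicator hm]
    have h := (first u hu huc).2
    simp_rw [mul_left_comm _ (12 : ℝ)] at h
    rw [integral_const_mul] at h
    simpa using h
  · rw [hind, integral_indicator hm]
    exact second u hu huc
  · intro c d hcd hI' h0
    obtain ⟨u, huJ, huc, hu, -, hu1⟩ := exists_contDiff_tsupport_subset (n := ⊤)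
      (isOpen_Ioo.mem_nhds (show (c + d) / 2 ∈ Set.Ioo c d by constructor <;> linarith))
    have hpos := hp.posDef u (huc.hasTemperateGrowth hu)
      ⟨(c + d) / 2, hI' (by constructor <;> linarith), by simp [hu1]⟩
    refine hpos.ne' ?_
    unfold form
    rw [← integral_indicator hm]
    refine integral_eq_zero_of_ae ?_
    filter_upwards [h0] with x hx
    by_cases hxI : x ∈ I
    · by_cases hxJ : x ∈ Set.Ioo c d
      · have := hx hxJ
        simp_all
      · have : u x = 0 := image_eq_zero_of_notMem_tsupport fun h => hxJ (huJ h)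
        simp [this]
    · simp [hxI]

end PolyDiffOp

/-! ### The weight between roots of `A₄` -/

theorem ContDiff.mul_contDiffOn_of_tsupport_subset {J : Set ℝ} (hJ : IsOpen J) {φ g : ℝ → ℝ}
    (hφ : ContDiff ℝ ∞ φ) (hφJ : tsupport φ ⊆ J) (hg : ContDiffOn ℝ ∞ g J) :
    ContDiff ℝ ∞ fun x => φ x * g x := by
  rw [contDiff_iff_contDiffAt]
  intro x
  by_cases hx : x ∈ J
  · exact hφ.contDiffAt.mul (hg.contDiffAt (hJ.mem_nhds hx))
  · have h0 := notMem_tsupport_iff_eventuallyEq.1 fun h => hx (hφJ h)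
    refine (contDiffAt_const (c := (0 : ℝ))).congr_of_eventuallyEq ?_
    filter_upwards [h0] with y hy
    simp [hy]

theorem Polynomial.contDiff_eval (q : Polynomial ℝ) : ContDiff ℝ ∞ fun x => q.eval x := by
  simpa using q.contDiff_aeval (𝕜 := ℝ) ∞

namespace PolyDiffOp

variable {A₁ A₂ A₃ A₄ : Polynomial ℝ} {I : Set ℝ} {P : ℝ → ℝ}

/-- The numerator `A₃ / 2 - A₄'` of the logarithmic derivative of the weight, whose denominator
is `A₄`. -/
noncomputable def logNum (A₃ A₄ : Polynomial ℝ) : Polynomial ℝ :=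
  Polynomial.C (1 / 2) * A₃ - Polynomial.derivative A₄

theorem eval_logNum (x : ℝ) :
    (logNum A₃ A₄).eval x = A₃.eval x / 2 - (Polynomial.derivative A₄).eval x := by
  simp [logNum]; ring

/-- The polynomial whose vanishing expresses that a weight with logarithmic derivative
`logNum A₃ A₄ / A₄` satisfies the second order equation. -/
noncomputable def compat (A₁ A₂ A₃ A₄ : Polynomial ℝ) : Polynomial ℝ :=
  let b := logNum A₃ A₄
  (A₃.derivative.derivative - 2 * A₂.derivative + 2 * A₁) * A₄ ^ 2 +
    (2 * A₃.derivative - 2 * A₂) * b * A₄ +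
    A₃ * (b.derivative * A₄ - b * A₄.derivative + b ^ 2)

/-- Lagrange's identity for the second order equation: the formal adjoint `(A₃ W)'' - 2 (A₂ W)' + 2
A₁ W` equals `W * compat / A₄ ^ 2`. -/
theorem hasDerivAt_boundaryTerm {W W₁ u : ℝ → ℝ} {x : ℝ} (hx : A₄.eval x ≠ 0)
    (hW : HasDerivAt W (W₁ x) x)
    (hW₁ : W₁ =ᶠ[nhds x] fun y => (logNum A₃ A₄).eval y / A₄.eval y * W y)
    (hu : ContDiff ℝ ∞ u) :
    HasDerivAt (fun y => A₃.eval y * W y * deriv u y +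
        (2 * A₂.eval y * W y - A₃.derivative.eval y * W y - A₃.eval y * W₁ y) * u y)
      (W x * (A₃.eval x * deriv (deriv u) x + 2 * A₂.eval x * deriv u x + 2 * A₁.eval x * u x) -
        u x * (W x * (compat A₁ A₂ A₃ A₄).eval x / A₄.eval x ^ 2)) x := by
  have hu0 := ((contDiff_infty_iff_deriv.1 hu).1 x).hasDerivAt
  have hu1 := ((contDiff_infty_iff_deriv.1 (contDiff_infty_iff_deriv.1 hu).2).1 x).hasDerivAt
  have hW2 : HasDerivAt W₁ _ x := (((((logNum A₃ A₄).hasDerivAt x).div (A₄.hasDerivAt x) hx).mul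
    hW).congr_of_eventuallyEq hW₁)
  have h1 := ((A₃.hasDerivAt x).mul hW).mul hu1
  have h2 := (((((A₂.hasDerivAt x).const_mul 2).mul hW).sub
    ((A₃.derivative.hasDerivAt x).mul hW)).sub ((A₃.hasDerivAt x).mul hW2)).mul hu0
  refine (h1.add h2).congr_deriv ?_
  simp only [compat, Pi.mul_apply, Pi.sub_apply, Pi.div_apply, hW₁.eq_of_nhds]
  simp
  field_simp
  ring

/-- Variation of constants in weak form: for `u = φ / (A₄ w)` one has `2 A₄ u' + A₃ u = 2 φ' / w`,
so `P / w` has weak derivative zero. -/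
theorem WeakWeight.exists_const (hP : WeakWeight A₁ A₂ A₃ A₄ I P) {J : Set ℝ} (hJ : IsOpen J)
    (hJc : J.OrdConnected) (hne : J.Nonempty) (hA : ∀ x ∈ J, A₄.eval x ≠ 0) {w : ℝ → ℝ}
    (hw : ContDiffOn ℝ ∞ w J) (hw0 : ∀ x ∈ J, w x ≠ 0)
    (hwd : ∀ x ∈ J, HasDerivAt w ((logNum A₃ A₄).eval x / A₄.eval x * w x) x) :
    ∃ C : ℝ, ∀ᵐ x, x ∈ J → P x = C * w x := by
  have hPi : Integrable P := by simpa using hP.integrable 1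
  have key : ∀ φ : ℝ → ℝ, ContDiff ℝ ∞ φ → HasCompactSupport φ → tsupport φ ⊆ J →
      ∫ x, P x * (w x)⁻¹ * deriv φ x = 0 := by
    intro φ hφ hφc hφJ
    have hg : ContDiffOn ℝ ∞ (fun x => (A₄.eval x * w x)⁻¹) J :=
      (A₄.contDiff_eval.contDiffOn.mul hw).inv fun x hx => mul_ne_zero (hA x hx) (hw0 x hx)
    have h := hP.first_order _ (hφ.mul_contDiffOn_of_tsupport_subset hJ hφJ hg) hφc.mul_right
    have e : ∀ x, P x * (2 * A₄.eval x * deriv (fun x => φ x * (A₄.eval x * w x)⁻¹) x +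
        A₃.eval x * (φ x * (A₄.eval x * w x)⁻¹)) = 2 * (P x * (w x)⁻¹ * deriv φ x) := by
      intro x
      by_cases hx : x ∈ J
      · have hφd := ((contDiff_infty_iff_deriv.1 hφ).1 x).hasDerivAt
        have hd := hφd.mul (((A₄.hasDerivAt x).mul (hwd x hx)).inv
          (mul_ne_zero (hA x hx) (hw0 x hx)))
        have h1 := hA x hx
        have h2 := hw0 x hx
        rw [show deriv (fun x => φ x * (A₄.eval x * w x)⁻¹) x = _ from hd.deriv, eval_logNum]
        simp only [Pi.mul_apply, Pi.inv_apply]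
        field_simp
        ring
      · have h0 := notMem_tsupport_iff_eventuallyEq.1 fun h => hx (hφJ h)
        have h1 : (fun x => φ x * (A₄.eval x * w x)⁻¹) =ᶠ[nhds x] fun _ => 0 := by
          filter_upwards [h0] with y hy
          simp [hy]
        rw [h1.deriv_eq, h0.deriv_eq, h0.eq_of_nhds]
        simp
    simp_rw [e] at h
    rw [integral_const_mul] at h
    simpa using h
  obtain ⟨C, hC⟩ := exists_const_of_integral_mul_deriv_eq_zero hJ hJc hne
    (f := fun x => P x * (w x)⁻¹)
    ((hPi.locallyIntegrable.locallyIntegrableOn J).mul_continuousOn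
      (hw.continuousOn.inv₀ hw0) hJ.isLocallyClosed) key
  refine ⟨C, ?_⟩
  filter_upwards [hC] with x hx hxJ
  have h2 := hw0 x hxJ
  have := hx hxJ
  field_simp at this
  linarith

/-- Positive solutions of `E' = (g / q) E` on an open interval without roots of `q`. -/
theorem exists_exp_solution {J : Set ℝ} (hJ : IsOpen J) (hJc : J.OrdConnected)
    {g q : Polynomial ℝ} (hq : ∀ x ∈ J, q.eval x ≠ 0) :
    ∃ E : ℝ → ℝ, ContDiffOn ℝ ∞ E J ∧ (∀ x, 0 < E x) ∧
      ∀ x ∈ J, HasDerivAt E (g.eval x / q.eval x * E x) x := by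
  obtain ⟨G, hG, hGd⟩ := exists_primitive_of_contDiffOn hJ hJc
    (k := fun x => g.eval x / q.eval x) (g.contDiff_eval.contDiffOn.div q.contDiff_eval.contDiffOn hq)
  refine ⟨fun x => Real.exp (G x), hG.exp, fun x => Real.exp_pos _, fun x hx => ?_⟩
  rw [mul_comm]
  exact (hGd x hx).exp

/-- Integration by parts turns the second order equation into `∫ φ R = 0` with `R = w * compat / A₄
^ 2`. Hence `compat` vanishes almost everywhere on an interval, which a nonzero polynomial cannot
do. -/
theorem WeakWeight.compat_eq_zero_of_Ioo (hP : WeakWeight A₁ A₂ A₃ A₄ I P) {c d : ℝ} (hcd : c < d)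
    (hI : Set.Ioo c d ⊆ I) (hA : ∀ x ∈ Set.Ioo c d, A₄.eval x ≠ 0) :
    compat A₁ A₂ A₃ A₄ = 0 := by
  have hJ : IsOpen (Set.Ioo c d) := isOpen_Ioo
  obtain ⟨w, hw, hwp, hwd⟩ := exists_exp_solution hJ Set.ordConnected_Ioo
    (g := logNum A₃ A₄) hA
  obtain ⟨C, hC⟩ := hP.exists_const hJ Set.ordConnected_Ioo (Set.nonempty_Ioo.2 hcd) hA hw
    (fun x _ => (hwp x).ne') hwd
  have hC0 : C ≠ 0 := by
    rintro rfl
    exact hP.not_ae_zero c d hcd hI (by simpa using hC)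
  set R : ℝ → ℝ := fun x => w x * (compat A₁ A₂ A₃ A₄).eval x / A₄.eval x ^ 2 with hR
  have hRc : ContDiffOn ℝ ∞ R (Set.Ioo c d) :=
    (hw.mul (Polynomial.contDiff_eval _).contDiffOn).div (A₄.contDiff_eval.pow 2).contDiffOn
      fun x hx => pow_ne_zero 2 (hA x hx)
  have key := hJ.ae_eq_zero_of_integral_contDiff_smul_eq_zero (f := R) (μ := volume)
    (hRc.continuousOn.locallyIntegrableOn hJ.measurableSet) ?_
  · by_contra hN
    have hfin : volume {x | (compat A₁ A₂ A₃ A₄).IsRoot x} = 0 :=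
      (Polynomial.finite_setOfPred_isRoot hN).measure_zero _
    have h0 : ∀ᵐ x, x ∉ Set.Ioo c d := by
      filter_upwards [key, measure_eq_zero_iff_ae_notMem.1 hfin] with x hx hr hxJ
      have := hx hxJ
      simp only [hR, div_eq_zero_iff, mul_eq_zero, (hwp x).ne', false_or,
        pow_ne_zero 2 (hA x hxJ), or_false] at this
      exact hr this
    have := measure_eq_zero_iff_ae_notMem.2 h0
    simp at this
    linarith
  intro φ hφ hφc hφJ
  have hφ' := (contDiff_infty_iff_deriv.1 hφ).2
  have hφJ' : tsupport (deriv φ) ⊆ Set.Ioo c d :=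
    (closure_minimal support_deriv_subset (isClosed_tsupport _)).trans hφJ
  set W₁ : ℝ → ℝ := fun y => (logNum A₃ A₄).eval y / A₄.eval y * w y
  have hW₁ : ContDiffOn ℝ ∞ W₁ (Set.Ioo c d) :=
    ((Polynomial.contDiff_eval _).contDiffOn.div A₄.contDiff_eval.contDiffOn hA).mul hw
  set F : ℝ → ℝ := fun y => A₃.eval y * w y * deriv φ y +
        (2 * A₂.eval y * w y - A₃.derivative.eval y * w y - A₃.eval y * W₁ y) * φ y with hF
  set S : ℝ → ℝ := fun x => w x * (A₃.eval x * deriv (deriv φ) x + 2 * A₂.eval x * deriv φ x +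
    2 * A₁.eval x * φ x) with hS
  have hFs : ContDiff ℝ ∞ F := by
    have h1 := hφ'.mul_contDiffOn_of_tsupport_subset hJ hφJ' (A₃.contDiff_eval.contDiffOn.mul hw)
    have h2 := hφ.mul_contDiffOn_of_tsupport_subset hJ hφJ
      ((((contDiff_const (c := (2 : ℝ))).mul A₂.contDiff_eval).contDiffOn.mul hw).sub
        (A₃.derivative.contDiff_eval.contDiffOn.mul hw) |>.sub (A₃.contDiff_eval.contDiffOn.mul hW₁))
    convert h1.add h2 using 1
    funext y
    simp only [hF]
    ring
  have hFc : HasCompactSupport F := by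
    exact hφc.deriv.mul_left.add hφc.mul_left
  have hd : ∀ x, deriv F x = S x - φ x * R x := by
    intro x
    by_cases hx : x ∈ Set.Ioo c d
    · exact (hasDerivAt_boundaryTerm (hA x hx) (hwd x hx) Filter.EventuallyEq.rfl hφ).deriv
    · have h0 := notMem_tsupport_iff_eventuallyEq.1 fun h => hx (hφJ h)
      have h1 : F =ᶠ[nhds x] fun _ => 0 := by
        filter_upwards [h0, h0.deriv] with y hy hy'
        simp [hF, hy, hy']
      rw [h1.deriv_eq]
      simp [hS, h0.eq_of_nhds, h0.deriv_eq, h0.deriv.deriv_eq]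
  have hdi : Integrable (deriv F) := (contDiff_infty_iff_deriv.1 hFs).2.continuous
    |>.integrable_of_hasCompactSupport hFc.deriv
  have hRi : Integrable fun x => φ x * R x :=
    (hφ.mul_contDiffOn_of_tsupport_subset hJ hφJ hRc).continuous.integrable_of_hasCompactSupport
      hφc.mul_right
  have hd0 : ∫ x, deriv F x = 0 :=
    integral_eq_zero_of_hasDerivAt_of_integrable
      (fun x => ((contDiff_infty_iff_deriv.1 hFs).1 x).hasDerivAt) hdi
      (hFs.continuous.integrable_of_hasCompactSupport hFc)
  have hS0 : ∫ x, S x = 0 := by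
    have h := hP.second_order φ hφ hφc
    have e : (fun x => P x * (A₃.eval x * deriv (deriv φ) x + 2 * A₂.eval x * deriv φ x +
        2 * A₁.eval x * φ x)) =ᵐ[volume] fun x => C * S x := by
      filter_upwards [hC] with x hx
      by_cases hxJ : x ∈ Set.Ioo c d
      · rw [hx hxJ]; simp only [hS]; ring
      · have h0 := notMem_tsupport_iff_eventuallyEq.1 fun h => hxJ (hφJ h)
        simp [hS, h0.eq_of_nhds, h0.deriv_eq, h0.deriv.deriv_eq]
    rw [integral_congr_ae e, integral_const_mul] at h
    simpa [hC0] using h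
  have hSe : S = fun x => deriv F x + φ x * R x := by
    funext x; rw [hd]; ring
  rw [hSe, integral_add hdi hRi, hd0, zero_add] at hS0
  simpa using hS0

theorem WeakWeight.compat_eq_zero (hP : WeakWeight A₁ A₂ A₃ A₄ I P) (hA : A₄ ≠ 0)
    (hI : (interior I).Nonempty) : compat A₁ A₂ A₃ A₄ = 0 := by
  have hfin := (Polynomial.finite_setOfPred_isRoot hA)
  obtain ⟨x, hxI, hx⟩ : (interior I ∩ {x | A₄.IsRoot x}ᶜ).Nonempty :=
    (Set.Countable.dense_compl ℝ (Set.Finite.countable hfin)) |>.inter_open_nonempty _ isOpen_interior hI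
  have hop : IsOpen (interior I ∩ {x | A₄.IsRoot x}ᶜ) :=
    isOpen_interior.inter (Set.Finite.isClosed hfin).isOpen_compl
  obtain ⟨c, d, hcd, hs⟩ := mem_nhds_iff_exists_Ioo_subset.1 (hop.mem_nhds ⟨hxI, hx⟩)
  exact hP.compat_eq_zero_of_Ioo (hcd.1.trans hcd.2)
    (fun y hy => interior_subset (hs hy).1) fun y hy => (hs hy).2

/-! ### Finite ends of the interval -/

theorem exists_Ioo_eval_ne_zero {q : Polynomial ℝ} {c₀ r : ℝ} (hc : c₀ < r) (hq : q.eval r ≠ 0) :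
    ∃ c d : ℝ, c₀ ≤ c ∧ c < r ∧ r < d ∧ ∀ x ∈ Set.Ioo c d, q.eval x ≠ 0 := by
  have h := (q.continuous.continuousAt (x := r)).eventually_ne hq
  obtain ⟨c, d, hcd, hs⟩ := mem_nhds_iff_exists_Ioo_subset.1 h
  exact ⟨max c c₀, d, le_max_right _ _, max_lt hcd.1 hc, hcd.2,
    fun x hx => hs ⟨(le_max_left _ _).trans_lt hx.1, hx.2⟩⟩

theorem WeakWeight.const_ne_zero (hP : WeakWeight A₁ A₂ A₃ A₄ I P) {c d : ℝ} (hcd : c < d)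
    (hI : Set.Ioo c d ⊆ I) {J : Set ℝ} (hJ : Set.Ioo c d ⊆ J) {C : ℝ} {w : ℝ → ℝ}
    (hC : ∀ᵐ x, x ∈ J → P x = C * w x) : C ≠ 0 := by
  rintro rfl
  refine hP.not_ae_zero c d hcd hI ?_
  filter_upwards [hC] with x hx hxJ
  simpa using hx (hJ hxJ)

/-- At the right end `r` of the interval, `A₃` has a smaller order of vanishing than `A₄`:
otherwise the weight is `E / A₄` with `E` smooth and positive at `r`, which is not integrable if
`A₄` vanishes at `r`, and violates the first order equation across `r` if not. -/
theorem WeakWeight.false_of_pow_dvd (hP : WeakWeight A₁ A₂ A₃ A₄ I P) {c₀ r : ℝ} (hc : c₀ < r)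
    (hI : Set.Ioo c₀ r ⊆ I) (hr : ∀ x, r < x → x ∉ I) {m : ℕ} {q g : Polynomial ℝ}
    (h4 : A₄ = (Polynomial.X - Polynomial.C r) ^ m * q)
    (h3 : A₃ = (Polynomial.X - Polynomial.C r) ^ m * g) (hq : q.eval r ≠ 0) : False := by
  obtain ⟨c, d, hc0, hcr, hrd, hqJ⟩ := exists_Ioo_eval_ne_zero hc hq
  have hIc : Set.Ioo c r ⊆ I := fun x hx => hI ⟨hc0.trans_lt hx.1, hx.2⟩
  obtain ⟨E, hE, hEp, hEd⟩ := exists_exp_solution (isOpen_Ioo (a := c) (b := d))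
    Set.ordConnected_Ioo (g := Polynomial.C (1 / 2) * g) hqJ
  have hsol : ∀ J : Set ℝ, IsOpen J → J.OrdConnected → J.Nonempty → J ⊆ Set.Ioo c d →
      (∀ x ∈ J, A₄.eval x ≠ 0) → ∃ C : ℝ, ∀ᵐ x, x ∈ J → P x = C * (E x / A₄.eval x) := by
    intro J hJ hJc hne hJs hA
    refine hP.exists_const hJ hJc hne hA
      ((hE.mono hJs).div A₄.contDiff_eval.contDiffOn hA)
      (fun x hx => div_ne_zero (hEp x).ne' (hA x hx)) fun x hx => ?_
    have hx4 := hA x hx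
    have hxq := hqJ x (hJs hx)
    have e4 : A₄.eval x = (x - r) ^ m * q.eval x := by simp [h4]
    have e3 : A₃.eval x = (x - r) ^ m * g.eval x := by simp [h3]
    refine ((hEd x (hJs hx)).div (A₄.hasDerivAt x) hx4).congr_deriv ?_
    have e : g.eval x * A₄.eval x = A₃.eval x * q.eval x := by rw [e4, e3]; ring
    have e' : g.eval x = A₃.eval x * q.eval x / A₄.eval x := by rw [← e]; field_simp
    rw [eval_logNum]
    simp only [Polynomial.eval_mul, Polynomial.eval_C, e']
    field_simp
  rcases Nat.eq_zero_or_pos m with rfl | hm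
  · obtain ⟨C, hC⟩ := hsol (Set.Ioo c d) isOpen_Ioo Set.ordConnected_Ioo
      ⟨r, hcr, hrd⟩ subset_rfl (fun x hx => by simpa [h4] using hqJ x hx)
    have hC0 := hP.const_ne_zero hcr hIc (Set.Ioo_subset_Ioo_right hrd.le) hC
    have h0 : ∀ᵐ x, x ∉ Set.Ioo r d := by
      filter_upwards [hC] with x hx hxJ
      have h1 := hx ⟨hcr.trans hxJ.1, hxJ.2⟩
      rw [hP.eq_zero x (hr x hxJ.1), eq_comm] at h1
      have h2 : A₄.eval x ≠ 0 := by simpa [h4] using hqJ x ⟨hcr.trans hxJ.1, hxJ.2⟩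
      exact mul_ne_zero hC0 (div_ne_zero (hEp x).ne' h2) h1
    have := measure_eq_zero_iff_ae_notMem.2 h0
    simp at this
    linarith
  · obtain ⟨C, hC⟩ := hsol (Set.Ioo c r) isOpen_Ioo Set.ordConnected_Ioo
      (Set.nonempty_Ioo.2 hcr) (Set.Ioo_subset_Ioo_right hrd.le) (fun x hx => by
        have := hqJ x ⟨hx.1, hx.2.trans hrd⟩
        simp [h4, sub_ne_zero.2 hx.2.ne, this])
    have hC0 := hP.const_ne_zero hcr hIc subset_rfl hC
    set c' := (c + r) / 2
    have hcc : c < c' := by simp only [c']; linarith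
    have hcr' : c' < r := by simp only [c']; linarith
    have hsub : Set.Icc c' r ⊆ Set.Ioo c d := fun x hx =>
      ⟨hcc.trans_le hx.1, hx.2.trans_lt hrd⟩
    have hHc : ContinuousOn (fun x => q.eval x * (x - r) ^ (m - 1) / E x) (Set.Icc c' r) :=
      ContinuousOn.div (by fun_prop) (hE.continuousOn.mono hsub) fun x _ => (hEp x).ne'
    obtain ⟨M, hM⟩ := isCompact_Icc.exists_bound_of_continuousOn hHc
    have hPi : Integrable P := by simpa using hP.integrable 1
    -- `1 / (x - r)` is a function bounded by `M` times `E / A₄`, so it is dominated by `(M / ‖C‖)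
    -- |P|`; integrability of `P` would pass to it.
    have hii : IntervalIntegrable (fun x => (x - r)⁻¹) volume c' r := by
      rw [intervalIntegrable_iff_integrableOn_Ioo_of_le hcr'.le]
      refine Integrable.mono' ((hPi.norm.const_mul (M / ‖C‖)).integrableOn)
        ((measurable_id.sub_const r).inv.aestronglyMeasurable) ?_
      rw [ae_restrict_iff' measurableSet_Ioo]
      filter_upwards [hC] with x hx hxJ
      have hxJ' : x ∈ Set.Ioo c r := ⟨hcc.trans hxJ.1, hxJ.2⟩
      have hMx := hM x ⟨hxJ.1.le, hxJ.2.le⟩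
      have hqx := hqJ x ⟨hxJ'.1, hxJ.2.trans hrd⟩
      have hxr : x - r ≠ 0 := sub_ne_zero.2 hxJ.2.ne
      have hEx := (hEp x).ne'
      have e : (x - r)⁻¹ = q.eval x * (x - r) ^ (m - 1) / E x * (E x / A₄.eval x) := by
        obtain ⟨k, rfl⟩ : ∃ k, m = k + 1 := ⟨m - 1, by omega⟩
        simp only [h4, Polynomial.eval_mul, Polynomial.eval_pow, Polynomial.eval_sub,
          Polynomial.eval_X, Polynomial.eval_C, Nat.add_sub_cancel, pow_succ]
        field_simp
      have hCn : ‖C‖ ≠ 0 := norm_ne_zero_iff.2 hC0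
      rw [hx hxJ', norm_mul C, ← mul_assoc, div_mul_cancel₀ M hCn, e, norm_mul]
      gcongr
    rw [intervalIntegrable_sub_inv_iff] at hii
    rcases hii with h | h
    · exact hcr'.ne h
    · exact h Set.right_mem_uIcc

/-- Since `compat = 0`, the boundary term is a primitive of the second order integrand on the left
of `r`. Integrating from a point left of the support of `u` leaves its value at `r`. The extension
`W` past `r` only gives meaning to that value. -/
theorem WeakWeight.boundaryTerm_eq_zero (hP : WeakWeight A₁ A₂ A₃ A₄ I P)
    (hN : compat A₁ A₂ A₃ A₄ = 0) {c r d : ℝ} (hc : c < r) (hd : r < d)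
    (hI : Set.Ioo c r ⊆ I) (hr : ∀ x, r < x → x ∉ I)
    (hA : ∀ x ∈ Set.Ioo c r, A₄.eval x ≠ 0) {W W₁ : ℝ → ℝ}
    (hW : ContDiffOn ℝ ∞ W (Set.Ioo c d)) (hW₁ : ContinuousOn W₁ (Set.Ioo c d))
    (hWd : ∀ x ∈ Set.Ioo c r, HasDerivAt W (W₁ x) x)
    (hW0 : ∀ x ∈ Set.Ioo c r, W x ≠ 0)
    (hWe : ∀ x ∈ Set.Ioo c r, W₁ x = (logNum A₃ A₄).eval x / A₄.eval x * W x)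
    {u : ℝ → ℝ} (hu : ContDiff ℝ ∞ u) (huc : HasCompactSupport u)
    (huJ : tsupport u ⊆ Set.Ioo c d) :
    A₃.eval r * W r * deriv u r +
      (2 * A₂.eval r * W r - A₃.derivative.eval r * W r - A₃.eval r * W₁ r) * u r = 0 := by
  obtain ⟨C, hC⟩ := hP.exists_const isOpen_Ioo Set.ordConnected_Ioo (Set.nonempty_Ioo.2 hc) hA
    (hW.mono (Set.Ioo_subset_Ioo_right hd.le)) hW0 (fun x hx => hWe x hx ▸ hWd x hx)
  have hC0 := hP.const_ne_zero hc hI subset_rfl hC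
  obtain ⟨x₀, hcx, hxr, hx₀⟩ : ∃ x₀, c < x₀ ∧ x₀ < r ∧ ∀ x ∈ tsupport u, x₀ < x := by
    rcases (tsupport u).eq_empty_or_nonempty with he | hn
    · exact ⟨(c + r) / 2, by linarith, by linarith, by simp [he]⟩
    · obtain ⟨m, hm⟩ := huc.isCompact.exists_isLeast hn
      have := (huJ hm.1).1
      refine ⟨(c + min m r) / 2, ?_, ?_, fun x hx => ?_⟩
      · have := lt_min this hc
        linarith
      · have := min_le_right m r
        linarith
      · have h1 := hm.2 hx
        have := min_le_left m r
        linarith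
  have hsub : Set.Icc x₀ r ⊆ Set.Ioo c d := fun x hx => ⟨hcx.trans_le hx.1, hx.2.trans_lt hd⟩
  have hu' := (contDiff_infty_iff_deriv.1 hu).2
  have hu'' := (contDiff_infty_iff_deriv.1 hu').2
  have hWc := hW.continuousOn.mono hsub
  have hW₁c := hW₁.mono hsub
  set F : ℝ → ℝ := fun y => A₃.eval y * W y * deriv u y +
    (2 * A₂.eval y * W y - A₃.derivative.eval y * W y - A₃.eval y * W₁ y) * u y with hF
  set S : ℝ → ℝ := fun x => W x * (A₃.eval x * deriv (deriv u) x + 2 * A₂.eval x * deriv u x +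
    2 * A₁.eval x * u x) with hS
  have hzero : ∀ x, x ≤ x₀ → u x = 0 ∧ deriv u x = 0 ∧ deriv (deriv u) x = 0 := fun x hx => by
    have h0 := notMem_tsupport_iff_eventuallyEq.1 fun h => (hx₀ x h).not_ge hx
    simp [h0.eq_of_nhds, h0.deriv_eq, h0.deriv.deriv_eq]
  have c0 := hu.continuous
  have c1 := hu'.continuous
  have c2 := hu''.continuous
  have hSc : ContinuousOn S (Set.Icc x₀ r) := hWc.mul (by fun_prop)
  have hFc : ContinuousOn F (Set.Icc x₀ r) := by
    simp only [hF]
    fun_prop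
  have hFTC : ∫ x in x₀..r, S x = F r - F x₀ := by
    refine intervalIntegral.integral_eq_sub_of_hasDerivAt_of_le hxr.le hFc (fun x hx => ?_)
      (hSc.intervalIntegrable_of_Icc hxr.le)
    have hxJ : x ∈ Set.Ioo c r := ⟨hcx.trans hx.1, hx.2⟩
    have h := hasDerivAt_boundaryTerm (A₁ := A₁) (A₂ := A₂) (hA x hxJ) (hWd x hxJ)
      (Filter.eventually_of_mem (isOpen_Ioo.mem_nhds hxJ) hWe) hu
    simpa [hN] using h
  have hF0 : F x₀ = 0 := by simp [hF, hzero x₀ le_rfl]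
  have hint : ∫ x in x₀..r, S x = 0 := by
    have h := hP.second_order u hu huc
    rw [intervalIntegral.integral_of_le hxr.le, ← integral_indicator measurableSet_Ioc]
    have e : (fun x => P x * (A₃.eval x * deriv (deriv u) x + 2 * A₂.eval x * deriv u x +
        2 * A₁.eval x * u x)) =ᵐ[volume] fun x => C * (Set.Ioc x₀ r).indicator S x := by
      filter_upwards [hC, measure_eq_zero_iff_ae_notMem.1 (measure_singleton (μ := volume) r)]
        with x hx hxr'
      by_cases hxJ : x ∈ Set.Ioc x₀ r
      · rw [hx ⟨hcx.trans hxJ.1, lt_of_le_of_ne hxJ.2 hxr'⟩, Set.indicator_of_mem hxJ]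
        simp only [hS]; ring
      · rw [Set.indicator_of_notMem hxJ]
        rcases le_or_gt x x₀ with hx1 | hx1
        · simp [hzero x hx1]
        · rw [hP.eq_zero x (hr x (not_le.1 fun h => hxJ ⟨hx1, h⟩))]
          simp
    rw [integral_congr_ae e, integral_const_mul] at h
    simpa [hC0] using h
  rw [hint, hF0, sub_zero] at hFTC
  exact hFTC.symm

theorem WeakWeight.false_of_simple (hP : WeakWeight A₁ A₂ A₃ A₄ I P)
    (hN : compat A₁ A₂ A₃ A₄ = 0) {c₀ r : ℝ} (hc : c₀ < r)
    (hI : Set.Ioo c₀ r ⊆ I) (hr : ∀ x, r < x → x ∉ I) {q : Polynomial ℝ}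
    (h4 : A₄ = (Polynomial.X - Polynomial.C r) * q) (hq : q.eval r ≠ 0)
    (h3 : A₃.eval r ≠ 0) : False := by
  obtain ⟨c, d, hc0, hcr, hrd, hqJ⟩ := exists_Ioo_eval_ne_zero hc hq
  have hIc : Set.Ioo c r ⊆ I := fun x hx => hI ⟨hc0.trans_lt hx.1, hx.2⟩
  have hA : ∀ x ∈ Set.Ioo c r, A₄.eval x ≠ 0 := fun x hx => by
    have := hqJ x ⟨hx.1, hx.2.trans hrd⟩
    simp [h4, sub_ne_zero.2 hx.2.ne, this]
  -- The local exponent of the weight at `r` is `b(r) / q(r)`; `compat = 0` at `r` forces it to be 0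
  -- or 1.
  have hb : (logNum A₃ A₄).eval r = 0 ∨ (logNum A₃ A₄ - q).eval r = 0 := by
    have h := congrArg (Polynomial.eval r) hN
    have e4 : A₄.eval r = 0 := by simp [h4]
    have e4' : A₄.derivative.eval r = q.eval r := by simp [h4]
    simp only [compat, Polynomial.eval_add, Polynomial.eval_mul, Polynomial.eval_pow,
      Polynomial.eval_sub, e4, e4', Polynomial.eval_zero] at h
    have h' : A₃.eval r * ((logNum A₃ A₄).eval r * ((logNum A₃ A₄).eval r - q.eval r)) = 0 := by
      linarith
    simpa [h3] using h'
  obtain ⟨χ, hχJ, hχc, hχ, -, hχ1⟩ := exists_contDiff_tsupport_subset (n := ⊤)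
    (isOpen_Ioo.mem_nhds (⟨hcr, hrd⟩ : r ∈ Set.Ioo c d))
  have hx4 : ∀ x, A₄.eval x = (x - r) * q.eval x := fun x => by simp [h4]
  rcases hb with hb | hb
  -- Exponent 0: the weight is nonzero at `r`, and a test function with `u(r) = 0`, `u'(r) = 1`
  -- isolates `A₃ W`.
  · obtain ⟨b₁, hb₁⟩ := Polynomial.dvd_iff_isRoot.2 hb
    have hxb : ∀ x, (logNum A₃ A₄).eval x = (x - r) * b₁.eval x := fun x => by simp [hb₁]
    obtain ⟨E, hE, hEp, hEd⟩ := exists_exp_solution (isOpen_Ioo (a := c) (b := d))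
      Set.ordConnected_Ioo (g := b₁) hqJ
    have hud : HasDerivAt (fun x => (x - r) * χ x) 1 r := by
      refine (((hasDerivAt_id r).sub_const r).mul
        ((contDiff_infty_iff_deriv.1 hχ).1 r).hasDerivAt).congr_deriv ?_
      simp [hχ1]
    have h := hP.boundaryTerm_eq_zero hN hcr hrd hIc hr hA (W := E)
      (W₁ := fun x => b₁.eval x / q.eval x * E x) hE
      ((b₁.continuous.continuousOn.div q.continuous.continuousOn hqJ).mul hE.continuousOn)
      (fun x hx => hEd x ⟨hx.1, hx.2.trans hrd⟩) (fun x _ => (hEp x).ne')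
      (fun x hx => by
        have h1 := hqJ x ⟨hx.1, hx.2.trans hrd⟩
        have h2 : x - r ≠ 0 := sub_ne_zero.2 hx.2.ne
        rw [hx4, hxb]
        field_simp)
      (u := fun x => (x - r) * χ x) ((contDiff_id.sub contDiff_const).mul hχ) hχc.mul_left
      ((closure_minimal ((Function.support_mul_subset_right _ _).trans (subset_tsupport χ))
        (isClosed_tsupport _)).trans hχJ)
    rw [hud.deriv] at h
    simp [h3, (hEp r).ne'] at h
  -- Exponent 1: now `W(r) = 0`, and only `-A₃ W₁ u` remains.
  · obtain ⟨b₁, hb₁⟩ := Polynomial.dvd_iff_isRoot.2 hb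
    have hxb : ∀ x, (logNum A₃ A₄).eval x = q.eval x + (x - r) * b₁.eval x := fun x => by
      have := congrArg (Polynomial.eval x) hb₁
      simp at this
      linarith
    obtain ⟨E, hE, hEp, hEd⟩ := exists_exp_solution (isOpen_Ioo (a := c) (b := d))
      Set.ordConnected_Ioo (g := b₁) hqJ
    have h := hP.boundaryTerm_eq_zero hN hcr hrd hIc hr hA (W := fun x => (r - x) * E x)
      (W₁ := fun x => -1 * E x + (r - x) * (b₁.eval x / q.eval x * E x))
      ((contDiff_const.sub contDiff_id).contDiffOn.mul hE)
      ((continuousOn_const.mul hE.continuousOn).add ((by fun_prop : ContinuousOn _ _).mul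
        ((b₁.continuous.continuousOn.div q.continuous.continuousOn hqJ).mul hE.continuousOn)))
      (fun x hx => ((hasDerivAt_id x).const_sub r).mul (hEd x ⟨hx.1, hx.2.trans hrd⟩))
      (fun x hx => mul_ne_zero (sub_ne_zero.2 hx.2.ne') (hEp x).ne')
      (fun x hx => by
        have h1 := hqJ x ⟨hx.1, hx.2.trans hrd⟩
        have h2 : x - r ≠ 0 := sub_ne_zero.2 hx.2.ne
        rw [hx4, hxb]
        field_simp
        ring) hχ hχc hχJ
    simp [h3, (hEp r).ne', hχ1] at h

/-- Behaviour of the coefficients at a finite right end of the interval. -/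
theorem WeakWeight.right_end (hP : WeakWeight A₁ A₂ A₃ A₄ I P)
    (hN : compat A₁ A₂ A₃ A₄ = 0) (hA : A₄ ≠ 0) {c₀ r : ℝ} (hc : c₀ < r)
    (hI : Set.Ioo c₀ r ⊆ I) (hr : ∀ x, r < x → x ∉ I) :
    2 ≤ A₄.rootMultiplicity r ∧
      (A₄.rootMultiplicity r = 2 → A₃.rootMultiplicity r = 1) := by
  obtain ⟨q, h4, hq⟩ := A₄.exists_eq_pow_rootMultiplicity_mul_and_not_dvd hA r
  rw [Polynomial.dvd_iff_isRoot] at hq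
  have hq : q.eval r ≠ 0 := hq
  set m := A₄.rootMultiplicity r
  have hm2 : 2 ≤ m := by
    by_contra! hlt
    interval_cases m
    · exact hP.false_of_pow_dvd hc hI hr h4 (g := A₃) (by simp) hq
    · by_cases h3 : A₃.eval r = 0
      · obtain ⟨g, hg⟩ := Polynomial.dvd_iff_isRoot.2 h3
        exact hP.false_of_pow_dvd hc hI hr h4 (g := g) (by simpa using hg) hq
      · exact hP.false_of_simple hN hc hI hr (by simpa using h4) hq h3
  refine ⟨hm2, fun hm => ?_⟩
  rw [hm] at h4
  -- At a double root of `A₄`, `b(r) = A₃(r) / 2`, so `compat = 0` reduces to the vanishing of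
  -- `A₃(r) ^ 3`.
  have h3 : A₃.eval r = 0 := by
    have h := congrArg (Polynomial.eval r) hN
    have e4 : A₄.eval r = 0 := by simp [h4]
    have e4' : A₄.derivative.eval r = 0 := by simp [h4, Polynomial.derivative_pow]
    simp [compat, eval_logNum, e4, e4'] at h
    exact h
  have hnd : ¬ (Polynomial.X - Polynomial.C r) ^ 2 ∣ A₃ := by
    rintro ⟨g, hg⟩
    exact hP.false_of_pow_dvd hc hI hr h4 hg hq
  have h30 : A₃ ≠ 0 := by
    rintro rfl
    exact hnd (dvd_zero _)
  have h1 : 1 ≤ A₃.rootMultiplicity r := (Polynomial.rootMultiplicity_pos h30).2 h3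
  have h2 : ¬ 2 ≤ A₃.rootMultiplicity r := by
    rwa [Polynomial.le_rootMultiplicity_iff h30]
  omega

end PolyDiffOp

/-! ### Root multiplicities and ends of intervals -/

theorem Polynomial.rootMultiplicity_comp_neg_X (p : Polynomial ℝ) (r : ℝ) :
    (p.comp (-Polynomial.X)).rootMultiplicity r = p.rootMultiplicity (-r) := by
  have := p.rootMultiplicity_comp_C_mul_X_add_C (-1) 0 r (by simp)
  simpa using this

theorem Polynomial.sum_rootMultiplicity_le (p : Polynomial ℝ) (T : Finset ℝ) :
    ∑ x ∈ T, p.rootMultiplicity x ≤ p.natDegree := by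
  classical
  refine le_trans ?_ p.card_roots'
  rw [← Multiset.toFinset_sum_count_eq]
  simp_rw [← Polynomial.count_roots]
  rw [← Finset.sum_filter_ne_zero]
  refine Finset.sum_le_sum_of_subset fun x hx => ?_
  rw [Multiset.mem_toFinset, ← Multiset.count_ne_zero]
  exact (Finset.mem_filter.1 hx).2

theorem Set.OrdConnected.right_end_or_Ioi_subset {I : Set ℝ} (hI : I.OrdConnected)
    (hne : (interior I).Nonempty) :
    (∃ c r, c < r ∧ Set.Ioo c r ⊆ I ∧ ∀ x, r < x → x ∉ I) ∨ ∃ R, Set.Ioi R ⊆ I := by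
  obtain ⟨x₀, hx₀⟩ := hne
  have hxI := interior_subset hx₀
  by_cases hb : BddAbove I
  · left
    obtain ⟨c, d, hcd, hs⟩ := mem_nhds_iff_exists_Ioo_subset.1 (mem_interior_iff_mem_nhds.1 hx₀)
    have hlt : x₀ < sSup I := by
      have h1 : (x₀ + d) / 2 ∈ I := hs ⟨by linarith [hcd.1, hcd.2], by linarith [hcd.2]⟩
      have := le_csSup hb h1
      linarith [hcd.2]
    refine ⟨x₀, sSup I, hlt, fun x hx => ?_, fun x hx hxI' => (le_csSup hb hxI').not_gt hx⟩
    obtain ⟨y, hy, hxy⟩ := exists_lt_of_lt_csSup ⟨x₀, hxI⟩ hx.2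
    exact hI.out hxI hy ⟨hx.1.le, hxy.le⟩
  · right
    refine ⟨x₀, fun x hx => ?_⟩
    obtain ⟨y, hy, hxy⟩ := not_bddAbove_iff.1 hb x
    exact hI.out hxI hy ⟨(Set.mem_Ioi.1 hx).le, hxy.le⟩

/-! ### Behaviour at infinity, reflection and degrees -/

namespace PolyDiffOp

variable {A₁ A₂ A₃ A₄ : Polynomial ℝ} {I : Set ℝ} {P : ℝ → ℝ}

/-- If the logarithmic derivative of the weight is at least `-N / x` near infinity, then the
interval is not unbounded to the right. -/
theorem WeakWeight.not_Ioi_subset (hP : WeakWeight A₁ A₂ A₃ A₄ I P) (hA : A₄ ≠ 0) (N : ℕ)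
    (h : ∀ᶠ x in Filter.atTop, -(N : ℝ) ≤ x * ((logNum A₃ A₄).eval x / A₄.eval x)) (R₀ : ℝ) :
    ¬ Set.Ioi R₀ ⊆ I := by
  intro hI
  have hne : ∀ᶠ x in Filter.atTop, A₄.eval x ≠ 0 := by
    have := (Polynomial.finite_setOfPred_isRoot hA).bddAbove
    obtain ⟨B, hB⟩ := this
    filter_upwards [Filter.eventually_gt_atTop B] with x hx h0
    exact (hB h0).not_gt hx
  obtain ⟨R, hR⟩ := Filter.eventually_atTop.1 (((hne.and h).and
    (Filter.eventually_gt_atTop (0 : ℝ))).and (Filter.eventually_gt_atTop R₀))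
  have hR' : ∀ x ∈ Set.Ioi R, _ := fun x hx => hR x (Set.mem_Ioi.1 hx).le
  obtain ⟨w, hw, hwp, hwd⟩ := exists_exp_solution (isOpen_Ioi (a := R)) Set.ordConnected_Ioi
    (g := logNum A₃ A₄) (q := A₄) (fun x hx => (hR' x hx).1.1.1)
  obtain ⟨C, hC⟩ := hP.exists_const isOpen_Ioi Set.ordConnected_Ioi Set.nonempty_Ioi
    (fun x hx => (hR' x hx).1.1.1) hw (fun x _ => (hwp x).ne') hwd
  have hC0 := hP.const_ne_zero (c := R) (d := R + 1) (by linarith)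
    (fun x hx => hI (hR' x hx.1).2) (fun x hx => hx.1) hC
  have hVd : ∀ x ∈ Set.Ioi R, HasDerivAt (fun x => x ^ N * w x)
      (N * x ^ (N - 1) * w x + x ^ N * ((logNum A₃ A₄).eval x / A₄.eval x * w x)) x :=
    fun x hx => (hasDerivAt_pow N x).mul (hwd x hx)
  have hsub : Set.Ici (R + 1) ⊆ Set.Ioi R := fun x hx => by
    have : R + 1 ≤ x := hx
    exact Set.mem_Ioi.2 (by linarith)
  -- By `h`, `x ^ N * w` is nondecreasing; then `|x ^ N P|` is at least `v * ‖C‖ > 0` on a ray,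
  -- against the convergence of moments.
  have hmono : MonotoneOn (fun x => x ^ N * w x) (Set.Ici (R + 1)) := by
    refine monotoneOn_of_deriv_nonneg (convex_Ici _)
      (fun x hx => (hVd x (hsub hx)).continuousAt.continuousWithinAt)
      (fun x hx => (hVd x (hsub (interior_subset hx))).differentiableAt.differentiableWithinAt)
      fun x hx => ?_
    have hxR := hsub (interior_subset hx)
    rw [(hVd x hxR).deriv]
    obtain ⟨⟨⟨h4, hN⟩, h0⟩, -⟩ := hR' x hxR
    refine nonneg_of_mul_nonneg_right (a := x) ?_ h0
    have hpow : (N : ℝ) * x ^ (N - 1) * x = N * x ^ N := by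
      cases N with
      | zero => simp
      | succ k => simp [pow_succ]; ring
    have e : x * (N * x ^ (N - 1) * w x + x ^ N * ((logNum A₃ A₄).eval x / A₄.eval x * w x)) =
        x ^ N * w x * (N + x * ((logNum A₃ A₄).eval x / A₄.eval x)) := by
      linear_combination w x * hpow
    rw [e]
    exact mul_nonneg (mul_nonneg (pow_nonneg h0.le N) (hwp x).le) (by linarith)
  have hv0 : 0 < (R + 1) ^ N * w (R + 1) :=
    mul_pos (pow_pos (hR' (R + 1) (hsub Set.self_mem_Ici)).1.2 N) (hwp _)
  set v := (R + 1) ^ N * w (R + 1)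
  have hint : IntegrableOn (fun _ : ℝ => v * ‖C‖) (Set.Ioi (R + 1)) := by
    refine Integrable.mono' (hP.integrable (Polynomial.X ^ N)).norm.integrableOn
      aestronglyMeasurable_const ?_
    rw [ae_restrict_iff' measurableSet_Ioi]
    filter_upwards [hC] with x hx hxR
    have hxi : x ∈ Set.Ici (R + 1) := (Set.mem_Ioi.1 hxR).le
    have hle : v ≤ x ^ N * w x := hmono Set.self_mem_Ici hxi hxi
    rw [hx (hsub hxi), Real.norm_of_nonneg (by positivity)]
    have e : C * w x * Polynomial.eval x (Polynomial.X ^ N) = (x ^ N * w x) * C := by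
      simp; ring
    rw [e, norm_mul (x ^ N * w x), Real.norm_of_nonneg (hv0.le.trans hle)]
    gcongr
  rw [integrableOn_const_iff] at hint
  simp [hv0.ne', hC0] at hint

/-- Here `x b / A₄` is bounded near infinity, and any natural bound serves as `N`. -/
theorem WeakWeight.not_Ioi_subset_of_natDegree_lt (hP : WeakWeight A₁ A₂ A₃ A₄ I P) (hA : A₄ ≠ 0)
    (hd : (logNum A₃ A₄).natDegree < A₄.natDegree) (R₀ : ℝ) : ¬ Set.Ioi R₀ ⊆ I := by
  have hle : (Polynomial.X * logNum A₃ A₄).degree ≤ A₄.degree := by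
    rw [Polynomial.degree_eq_natDegree hA]
    refine Polynomial.degree_le_of_natDegree_le (Polynomial.natDegree_mul_le.trans ?_)
    rw [Polynomial.natDegree_X]
    omega
  obtain ⟨c, hc⟩ := (Polynomial.isBigO_atTop_of_degree_le _ _ hle).bound
  obtain ⟨N, hN⟩ := exists_nat_ge c
  refine hP.not_Ioi_subset hA N ?_ R₀
  filter_upwards [hc] with x hx
  rcases eq_or_ne (A₄.eval x) 0 with h0 | h0
  · simp [h0]
  have h1 : |x * ((logNum A₃ A₄).eval x / A₄.eval x)| ≤ N := by
    rw [← mul_div_assoc, abs_div, div_le_iff₀ (abs_pos.2 h0)]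
    simp only [Polynomial.eval_mul, Polynomial.eval_X, Real.norm_eq_abs] at hx
    exact hx.trans (mul_le_mul_of_nonneg_right hN (abs_nonneg _))
  exact (abs_le.1 h1).1

/-- The quotient `b / A₄` has a positive limit, so `N = 0` suffices. -/
theorem WeakWeight.not_Ioi_subset_of_natDegree_eq (hP : WeakWeight A₁ A₂ A₃ A₄ I P) (hA : A₄ ≠ 0)
    (hd : (logNum A₃ A₄).natDegree = A₄.natDegree)
    (hpos : 0 < (logNum A₃ A₄).leadingCoeff / A₄.leadingCoeff) (R₀ : ℝ) : ¬ Set.Ioi R₀ ⊆ I := by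
  have hb : logNum A₃ A₄ ≠ 0 := by
    intro h
    simp [h] at hpos
  refine hP.not_Ioi_subset hA 0 ?_ R₀
  have ht := Polynomial.div_tendsto_atTop_leadingCoeff_div_of_degree_eq (logNum A₃ A₄) A₄
    (by rw [Polynomial.degree_eq_natDegree hA, Polynomial.degree_eq_natDegree hb, hd])
  filter_upwards [ht.eventually (lt_mem_nhds hpos), Filter.eventually_gt_atTop 0] with x hx hx0
  simpa using (mul_pos hx0 hx).le

/-- Transfers all results on right ends to left ends; under `x ↦ -x` the odd-order coefficients
change sign. -/
theorem WeakWeight.reflect (hP : WeakWeight A₁ A₂ A₃ A₄ I P) :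
    WeakWeight (-A₁.comp (-Polynomial.X)) (A₂.comp (-Polynomial.X)) (-A₃.comp (-Polynomial.X))
      (A₄.comp (-Polynomial.X)) (Neg.neg ⁻¹' I) (fun x => P (-x)) := by
  have hdr : ∀ u : ℝ → ℝ, deriv (fun x => u (-x)) = fun x => -deriv u (-x) := fun u => by
    funext x; exact deriv_comp_neg u x
  have hdrr : ∀ u : ℝ → ℝ, deriv (deriv fun x => u (-x)) = fun x => deriv (deriv u) (-x) := by
    intro u
    rw [hdr u]
    funext x
    have h := congrFun (hdr (deriv u)) x
    rw [deriv.fun_neg, h, neg_neg]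
  refine ⟨fun q => ?_, fun u hu huc => ?_, fun u hu huc => ?_, fun x hx => hP.eq_zero _ hx, ?_⟩
  · have := (hP.integrable (q.comp (-Polynomial.X))).comp_neg
    simpa using this
  · have h := hP.first_order (fun x => u (-x)) (hu.comp contDiff_neg)
      (huc.comp_homeomorph (Homeomorph.neg ℝ))
    rw [← integral_neg_eq_self, ← neg_eq_zero, ← integral_neg]
    rw [hdr] at h
    rw [← h]
    congr 1
    funext x
    simp
    ring
  · have h := hP.second_order (fun x => u (-x)) (hu.comp contDiff_neg)
      (huc.comp_homeomorph (Homeomorph.neg ℝ))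
    rw [← integral_neg_eq_self, ← neg_eq_zero, ← integral_neg]
    rw [hdrr, hdr] at h
    rw [← h]
    congr 1
    funext x
    simp
    ring
  · intro c d hcd hI h0
    refine hP.not_ae_zero (-d) (-c) (by linarith) (fun x hx => ?_) ?_
    · have := @hI (-x) ⟨by linarith [hx.2], by linarith [hx.1]⟩
      simpa using this
    · have h1 := (Measure.measurePreserving_neg (volume : Measure ℝ)).quasiMeasurePreserving.ae h0
      filter_upwards [h1] with x hx hxJ
      simpa using hx ⟨by linarith [hxJ.2], by linarith [hxJ.1]⟩

theorem logNum_reflect : logNum (-A₃.comp (-Polynomial.X)) (A₄.comp (-Polynomial.X)) =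
    -(logNum A₃ A₄).comp (-Polynomial.X) := by
  simp [logNum, Polynomial.derivative_comp]
  ring

/-- Outside both alternatives `deg b ≥ 3`, and `A₃ = 2 b + 2 A₄'` has the degree of `b`. Then `A₃ b
^ 2` alone reaches degree `3 deg b` in `compat`. For degrees equal to 2 the term `A₂ b A₄` can
cancel it. -/
theorem natDegree_logNum (hN : compat A₁ A₂ A₃ A₄ = 0) (h1 : A₁.natDegree ≤ 1)
    (h2 : A₂.natDegree ≤ 2) (h4 : 2 ≤ A₄.natDegree) :
    (logNum A₃ A₄).natDegree < A₄.natDegree ∨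
      (logNum A₃ A₄).natDegree = A₄.natDegree ∧ A₄.natDegree = 2 := by
  by_contra! hcon
  obtain ⟨hle, hne⟩ := hcon
  set b := logNum A₃ A₄ with hb
  set β := b.natDegree with hβ
  set d := A₄.natDegree with hd
  have hb0 : b ≠ 0 := by
    intro h
    simp [hβ, h] at hle
    omega
  have hA3 : A₃ = 2 * b + 2 * Polynomial.derivative A₄ := by
    have : (2 : Polynomial ℝ) * Polynomial.C (1 / 2) = 1 := by
      rw [← Polynomial.C_ofNat, ← Polynomial.C_mul]; norm_num
    rw [hb, logNum]
    linear_combination (-A₃) * this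
  have h4' : A₄.derivative.natDegree ≤ d - 1 := Polynomial.natDegree_derivative_le A₄
  have hC2 : (2 : Polynomial ℝ) = Polynomial.C 2 := rfl
  have h3deg : A₃.natDegree = β := by
    rw [hA3, hC2, Polynomial.natDegree_add_eq_left_of_natDegree_lt,
      Polynomial.natDegree_C_mul two_ne_zero]
    rw [Polynomial.natDegree_C_mul two_ne_zero, Polynomial.natDegree_C_mul two_ne_zero]
    omega
  have h30 : A₃ ≠ 0 := by
    intro h
    rw [h, Polynomial.natDegree_zero] at h3deg
    omega
  have h3' : A₃.derivative.natDegree ≤ β - 1 := h3deg ▸ Polynomial.natDegree_derivative_le A₃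
  have h3'' : A₃.derivative.derivative.natDegree ≤ β - 1 :=
    (Polynomial.natDegree_derivative_le _).trans (by omega)
  have hb' : b.derivative.natDegree ≤ β - 1 := Polynomial.natDegree_derivative_le b
  have h2' : A₂.derivative.natDegree ≤ β - 1 :=
    (Polynomial.natDegree_derivative_le _).trans (by omega)
  have hmul2 : ∀ (p : Polynomial ℝ) (n : ℕ), p.natDegree ≤ n → (2 * p).natDegree ≤ n :=
    fun p n h => by rw [hC2, Polynomial.natDegree_C_mul two_ne_zero]; exact h
  have e : A₃ * b ^ 2 = -((A₃.derivative.derivative - 2 * A₂.derivative + 2 * A₁) * A₄ ^ 2 +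
      (2 * A₃.derivative - 2 * A₂) * b * A₄ +
      A₃ * (b.derivative * A₄ - b * A₄.derivative)) := by
    have h := hN
    simp only [compat] at h
    rw [← hb] at h
    linear_combination h
  have hl : (A₃ * b ^ 2).natDegree = 3 * β := by
    rw [Polynomial.natDegree_mul h30 (pow_ne_zero 2 hb0), Polynomial.natDegree_pow, h3deg]
    ring
  have hr : (A₃ * b ^ 2).natDegree ≤ 3 * β - 1 := by
    rw [e, Polynomial.natDegree_neg]
    refine Polynomial.natDegree_add_le_of_degree_le
      (Polynomial.natDegree_add_le_of_degree_le ?_ ?_) ?_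
    · refine (Polynomial.natDegree_mul_le_of_le (m := β - 1) (n := 2 * d) ?_ ?_).trans (by omega)
      · exact Polynomial.natDegree_add_le_of_degree_le
          ((Polynomial.natDegree_sub_le_of_le h3'' (hmul2 _ _ h2')).trans (by simp))
          (hmul2 _ _ (by omega))
      · exact Polynomial.natDegree_pow_le
    · refine (Polynomial.natDegree_mul_le_of_le (Polynomial.natDegree_mul_le_of_le
        (Polynomial.natDegree_sub_le_of_le (hmul2 _ _ h3') (hmul2 _ _ h2)) hβ.ge) hd.ge).trans ?_
      omega
    · refine (Polynomial.natDegree_mul_le_of_le h3deg.le (Polynomial.natDegree_sub_le_of_le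
        (Polynomial.natDegree_mul_le_of_le hb' hd.ge)
        (Polynomial.natDegree_mul_le_of_le hβ.ge h4'))).trans ?_
      omega
  omega

end PolyDiffOp

/-! ### Counting the roots of `a₄` -/

theorem corollary3p5 (a : ℕ → Polynomial ℝ)
    (hL : PolyDiffOp.IsSelfAdjointOfOrder 4 a)
    (hroots : 1 < {r : ℝ | (a 4).IsRoot r}.encard) :
    {r : ℝ | (a 4).IsRoot r}.encard = 2 ∧
      ∀ r : ℝ, (a 4).IsRoot r →
        (a 4).rootMultiplicity r = 2 ∧ (a 3).rootMultiplicity r = 1 := by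
  obtain ⟨⟨hA, hdeg⟩, I, p, hI, hne, hp, hsym⟩ := hL
  have hP := PolyDiffOp.WeakWeight.of_isAdmissibleWeight hI hp hsym
  have hN := hP.compat_eq_zero hA hne
  have hP' := hP.reflect
  have hI' : (Neg.neg ⁻¹' I : Set ℝ).OrdConnected := ⟨fun x hx y hy z hz =>
    hI.out hy hx ⟨neg_le_neg hz.2, neg_le_neg hz.1⟩⟩
  have hne' : (interior (Neg.neg ⁻¹' I : Set ℝ)).Nonempty := by
    obtain ⟨x, hx⟩ := hne
    refine ⟨-x, preimage_interior_subset_interior_preimage continuous_neg ?_⟩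
    simpa using hx
  have hA' : (a 4).comp (-Polynomial.X) ≠ 0 := fun h => hA (by
    have := congrArg (fun q => q.comp (-Polynomial.X)) h
    simpa [Polynomial.comp_assoc] using this)
  have hN' := hP'.compat_eq_zero hA' hne'
  have hnatX : (-Polynomial.X : Polynomial ℝ).natDegree = 1 := by simp
  obtain ⟨r₁, r₂, hr₁, hr₂, hr⟩ := Set.one_lt_encard_iff.1 hroots
  have hm₁ : 1 ≤ (a 4).rootMultiplicity r₁ := (Polynomial.rootMultiplicity_pos hA).2 hr₁
  have hm₂ : 1 ≤ (a 4).rootMultiplicity r₂ := (Polynomial.rootMultiplicity_pos hA).2 hr₂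
  have hpair : ∀ x y : ℝ, x ≠ y →
      (a 4).rootMultiplicity x + (a 4).rootMultiplicity y ≤ (a 4).natDegree := fun x y hxy => by
    have := (a 4).sum_rootMultiplicity_le {x, y}
    rwa [Finset.sum_pair hxy] at this
  have h2 := hpair r₁ r₂ hr
  have hright : ∀ c r, c < r → Set.Ioo c r ⊆ I → (∀ x, r < x → x ∉ I) →
      2 ≤ (a 4).rootMultiplicity r ∧
        ((a 4).rootMultiplicity r = 2 → (a 3).rootMultiplicity r = 1) := fun c r hc hs hx =>
    hP.right_end hN hA hc hs hx
  have hleft : ∀ c r, c < r → Set.Ioo c r ⊆ Neg.neg ⁻¹' I → (∀ x, r < x → x ∉ Neg.neg ⁻¹' I) →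
      2 ≤ (a 4).rootMultiplicity (-r) ∧
        ((a 4).rootMultiplicity (-r) = 2 → (a 3).rootMultiplicity (-r) = 1) := by
    intro c r hc hs hx
    have := hP'.right_end hN' hA' hc hs hx
    rwa [← Polynomial.neg_comp, Polynomial.rootMultiplicity_comp_neg_X,
      Polynomial.rootMultiplicity_comp_neg_X, ← Polynomial.count_roots (-a 3), Polynomial.roots_neg,
      Polynomial.count_roots] at this
  rcases PolyDiffOp.natDegree_logNum hN (hdeg 1 (by decide)) (hdeg 2 (by decide)) (by omega)
    with hlt | ⟨heq, hd2⟩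
  · obtain ⟨c, r, hc, hs, hx⟩ := (hI.right_end_or_Ioi_subset hne).resolve_right
      fun ⟨R, h⟩ => hP.not_Ioi_subset_of_natDegree_lt hA hlt R h
    obtain ⟨c', l, hc', hs', hx'⟩ := (hI'.right_end_or_Ioi_subset hne').resolve_right
      fun ⟨R, h⟩ => hP'.not_Ioi_subset_of_natDegree_lt hA' (by
        rw [PolyDiffOp.logNum_reflect, Polynomial.natDegree_neg, Polynomial.natDegree_comp,
          Polynomial.natDegree_comp, hnatX]
        simpa using hlt) R h
    obtain ⟨hr2, hr3⟩ := hright c r hc hs hx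
    obtain ⟨hl2, hl3⟩ := hleft c' l hc' hs' hx'
    have hlr : -l ≠ r := by
      intro h
      refine hx' (-((c + r) / 2)) (by linarith) ?_
      simpa using hs ⟨by linarith, by linarith⟩
    have h4 := hdeg 4 (by decide)
    have hsum := hpair (-l) r hlr
    -- The ends `-l` and `r` already use up multiplicity 4.
    have hall : ∀ s : ℝ, (a 4).IsRoot s → s = -l ∨ s = r := by
      intro s hs
      by_contra! hcon
      have := (a 4).sum_rootMultiplicity_le {s, -l, r}
      rw [Finset.sum_insert (by simp [hcon]), Finset.sum_pair hlr] at this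
      have : 1 ≤ (a 4).rootMultiplicity s := (Polynomial.rootMultiplicity_pos hA).2 hs
      omega
    have hset : {r : ℝ | (a 4).IsRoot r} = {-l, r} := by
      ext s
      refine ⟨hall s, ?_⟩
      rintro (rfl | rfl)
      · exact (Polynomial.rootMultiplicity_pos hA).1 (by omega)
      · exact (Polynomial.rootMultiplicity_pos hA).1 (by omega)
    refine ⟨by rw [hset, Set.encard_pair hlr], fun s hs => ?_⟩
    rcases hall s hs with rfl | rfl
    · have : (a 4).rootMultiplicity (-l) = 2 := by omega
      exact ⟨this, hl3 this⟩
    · have : (a 4).rootMultiplicity s = 2 := by omega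
      exact ⟨this, hr3 this⟩
  · exfalso
    -- A quadratic with two distinct roots has no double root, so `I` has no finite end.
    have hno : ∀ r, ¬ 2 ≤ (a 4).rootMultiplicity r := by
      intro r h
      by_cases h1 : r = r₁
      · have := hpair r r₂ (h1 ▸ hr)
        omega
      · have := hpair r r₁ h1
        omega
    obtain ⟨R, hR⟩ := (hI.right_end_or_Ioi_subset hne).resolve_left
      fun ⟨c, r, hc, hs, hx⟩ => hno _ (hright c r hc hs hx).1
    obtain ⟨R', hR'⟩ := (hI'.right_end_or_Ioi_subset hne').resolve_left
      fun ⟨c, r, hc, hs, hx⟩ => hno _ (hleft c r hc hs hx).1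
    have hb : PolyDiffOp.logNum (a 3) (a 4) ≠ 0 := by
      intro h
      simp [h] at heq
      omega
    rcases (div_ne_zero (Polynomial.leadingCoeff_ne_zero.2 hb)
      (Polynomial.leadingCoeff_ne_zero.2 hA)).lt_or_gt with hneg | hpos
    -- Reflection negates the ratio of leading coefficients, both degrees being 2, so the weight
    -- does not decay toward `-∞`.
    · refine hP'.not_Ioi_subset_of_natDegree_eq hA' ?_ ?_ R' hR'
      · rw [PolyDiffOp.logNum_reflect, Polynomial.natDegree_neg, Polynomial.natDegree_comp,
          Polynomial.natDegree_comp, heq]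
      · rw [PolyDiffOp.logNum_reflect, Polynomial.leadingCoeff_neg,
          Polynomial.leadingCoeff_comp (by simp), Polynomial.leadingCoeff_comp (by simp), heq, hd2]
        simp only [Polynomial.leadingCoeff_neg, Polynomial.leadingCoeff_X]
        norm_num
        simpa [neg_div] using hneg
    · exact hP.not_Ioi_subset_of_natDegree_eq hA heq hpos R hR
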